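/- Let $K$ be a field with a real-valued valuation $\mathrm{val}$ (possibly trivial), let $n\ge 1$ and let $I\subseteq K[x_1,\dots,x_n]$ be a homogeneous ideal. For $w\in\mathbb R^n$ the initial form $\mathrm{in}_w(f)$ of $f=\sum_m c_m x^m$ consists of the terms with $c_m\neq 0$ for which $\mathrm{val}(c_m)+w\cdot m$ is minimal; let $\mathrm{trop}(f)=\{w\in\mathbb R^n : \mathrm{in}_w(f)\text{ is not a monomial}\}$ (so $\mathrm{trop}(0)=\mathbb R^n$) and $\mathrm{trop}(I)=\bigcap_{f\in I}\mathrm{trop}(f)$. Let $T$ be a tropical basis of $I$, that is, a finite generating set of $I$ with $\mathrm{trop}(I)=\bigcap_{h\in T}\mathrm{trop}(h)$. Suppose that $T$ consists of $s$ homogeneous polynomials of degree at most $d$ with constant coefficients, i.e. all their nonzero coefficients have valuation $0$ (no condition if $\mathrm{val}$ is trivial). Then those closed cones (of all dimensions) of the common refinement of the normal fans of the Newton polytopes of the $h\in T$ that are contained in $\mathrm{trop}(I)$ form a finite polyhedral complex with support $\mathrm{trop}(I)$. If $f_j(\mathrm{trop}(I))$ denotes the number of its cells (which are invariant under translation by $(1,\dots,1)$,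 as $T$ is homogeneous) whose image in $\mathbb R^n/\mathbb R\cdot(1,\dots,1)$ has dimension $j$, then $$f_j(\mathrm{trop}(I))\ \le\ \lambda_{n-j-1}(sd,n)\qquad\text{for } 0\le j\le n-1 .$$ Here $\lambda_k(d,n)$ is the maximal number of $k$-dimensional faces of a lattice polytope $P\subseteq d\cdot\Delta_{n-1}$, where $\Delta_{n-1}$ is the convex hull of the standard basis vectors of $\mathbb R^n$. -/

import Mathlib

open scoped Pointwise

noncomputable section

namespace TropBasis

/-! ### Polyhedra and polyhedral complexes in `ℝⁿ` -/

/-- A polyhedron: the solution set of finitely many weak affine inequalities. -/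
def IsPolyhedron {n : ℕ} (P : Set (Fin n → ℝ)) : Prop :=
  ∃ H : Set (Module.Dual ℝ (Fin n → ℝ) × ℝ), H.Finite ∧ P = {x | ∀ p ∈ H, p.2 ≤ p.1 x}

/-- `F` is a nonempty face of `P` (the face `P` itself is allowed). -/
def IsFaceOf {n : ℕ} (F P : Set (Fin n → ℝ)) : Prop :=
  F.Nonempty ∧ IsExposed ℝ P F

/-- A finite polyhedral complex, given by the set of its nonempty cells. -/
structure IsPolyhedralComplex {n : ℕ} (C : Set (Set (Fin n → ℝ))) : Prop where
  finite : C.Finite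
  nonempty : ∀ σ ∈ C, σ.Nonempty
  polyhedron : ∀ σ ∈ C, IsPolyhedron σ
  face_mem : ∀ σ ∈ C, ∀ F, IsFaceOf F σ → F ∈ C
  inter_face : ∀ σ ∈ C, ∀ τ ∈ C, (σ ∩ τ).Nonempty → IsFaceOf (σ ∩ τ) σ ∧ IsFaceOf (σ ∩ τ) τ

/-- The dimension of the affine span of a nonempty set. -/
def affDim {n : ℕ} (σ : Set (Fin n → ℝ)) : ℕ :=
  Module.finrank ℝ (vectorSpan ℝ σ)

/-- The line `ℝ·(1,…,1)`. -/
def onesLine (n : ℕ) : Submodule ℝ (Fin n → ℝ) :=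
  Submodule.span ℝ {fun _ => (1 : ℝ)}

/-- The dimension of (the affine span of) the image of a nonempty set in `ℝⁿ/ℝ·(1,…,1)`. -/
def projDim {n : ℕ} (σ : Set (Fin n → ℝ)) : ℕ :=
  Module.finrank ℝ ((vectorSpan ℝ σ).map (onesLine n).mkQ)

/-- The number `f_j` of cells of `C` whose image in `ℝⁿ/ℝ·(1,…,1)` has dimension `j`.
(When all cells are invariant under translation by `ℝ·(1,…,1)`, distinct cells have distinct
images, so that this is the `f`-vector of the image complex.) -/
def fVector {n : ℕ} (C : Set (Set (Fin n → ℝ))) (j : ℕ) : ℕ :=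
  {σ ∈ C | projDim σ = j}.ncard

/-! ### Lattice polytopes in dilated simplices -/

/-- A nonempty lattice polytope: the convex hull of finitely many points of `ℤⁿ`. -/
def IsLatticePolytope {n : ℕ} (P : Set (Fin n → ℝ)) : Prop :=
  ∃ V : Finset (Fin n → ℤ), V.Nonempty ∧
    P = convexHull ℝ ((fun z i => ((z i : ℤ) : ℝ)) '' (V : Set (Fin n → ℤ)))

/-- The number of `k`-dimensional faces of `P`. -/
def faceNumber {n : ℕ} (P : Set (Fin n → ℝ)) (k : ℕ) : ℕ :=
  {F | IsFaceOf F P ∧ affDim F = k}.ncard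

/-- The numbers of `k`-faces of the lattice polytopes contained in `d·Δ_{n-1}`. -/
def latticeFaceNumbers (k d n : ℕ) : Set ℕ :=
  {N | ∃ P : Set (Fin n → ℝ), IsLatticePolytope P ∧ P ⊆ (d : ℝ) • stdSimplex ℝ (Fin n) ∧
    faceNumber P k = N}

/-- `λ_k(d,n)`, the maximal number of `k`-faces of a lattice polytope contained in `d·Δ_{n-1}`.
For `n ≥ 1` the maximum exists, see `isGreatest_lam`. -/
def lam (k d n : ℕ) : ℕ :=
  sSup (latticeFaceNumbers k d n)

theorem latticeFaceNumbers_finite (k d n : ℕ) : (latticeFaceNumbers k d n).Finite := by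
  classical
  let ι : (Fin n → ℤ) → (Fin n → ℝ) := fun z i => ((z i : ℤ) : ℝ)
  let B : Finset (Fin n → ℤ) := Fintype.piFinset fun _ => Finset.Icc (0 : ℤ) d
  have hfin : {V : Finset (Fin n → ℤ) | V ⊆ B}.Finite := by
    have h : {V : Finset (Fin n → ℤ) | V ⊆ B} = (B.powerset : Set (Finset (Fin n → ℤ))) := by
      ext V; simp
    rw [h]; exact Finset.finite_toSet _
  refine (hfin.image fun V : Finset (Fin n → ℤ) => faceNumber (convexHull ℝ (ι '' (V : Set (Fin n → ℤ)))) k).subset ?_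
  rintro N ⟨P, ⟨V, hV, rfl⟩, hP, rfl⟩
  refine ⟨V, fun z hz => ?_, rfl⟩
  obtain ⟨y, hy, hyz⟩ := hP (subset_convexHull ℝ _ ⟨z, hz, rfl⟩)
  refine Fintype.mem_piFinset.2 fun i => Finset.mem_Icc.2 ?_
  have h1 : (d : ℝ) * y i = z i := by simpa using congrFun hyz i
  have h0 : 0 ≤ y i := hy.1 i
  have h2 : y i ≤ 1 := by
    rw [← hy.2]; exact Finset.single_le_sum (fun j _ => hy.1 j) (Finset.mem_univ i)
  have hd : (0 : ℝ) ≤ d := Nat.cast_nonneg d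
  constructor
  · have : (0 : ℝ) ≤ z i := by rw [← h1]; positivity
    exact_mod_cast this
  · have : (z i : ℝ) ≤ d := by rw [← h1]; nlinarith
    exact_mod_cast this

theorem latticeFaceNumbers_nonempty (k d : ℕ) {n : ℕ} (hn : 1 ≤ n) :
    (latticeFaceNumbers k d n).Nonempty := by
  classical
  let i0 : Fin n := ⟨0, hn⟩
  refine ⟨_, _, ⟨{Pi.single i0 (d : ℤ)}, Finset.singleton_nonempty _, rfl⟩, ?_, rfl⟩
  rw [Finset.coe_singleton, Set.image_singleton, convexHull_singleton, Set.singleton_subset_iff]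
  refine ⟨Pi.single i0 1, single_mem_stdSimplex ℝ i0, ?_⟩
  funext i
  by_cases h : i = i0
  · subst h; simp
  · simp [h]

theorem isGreatest_lam (k d : ℕ) {n : ℕ} (hn : 1 ≤ n) :
    IsGreatest (latticeFaceNumbers k d n) (lam k d n) :=
  ⟨Nat.sSup_mem (latticeFaceNumbers_nonempty k d hn) (latticeFaceNumbers_finite k d n).bddAbove,
    fun _ h => le_csSup (latticeFaceNumbers_finite k d n).bddAbove h⟩

/-! ### Tropical hypersurfaces, tropical varieties and tropical bases

`K` is a field with a real-valued valuation `v`; conventions are those of tropical geometry with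
the minimum. -/

variable {K : Type*} [Field K] {n : ℕ}

/-- `I` is a homogeneous ideal: it contains the homogeneous components of its members. -/
def IsHomogeneousIdeal (I : Ideal (MvPolynomial (Fin n) K)) : Prop :=
  ∀ f ∈ I, ∀ e : ℕ, MvPolynomial.homogeneousComponent e f ∈ I

/-- The `w`-weight `val(c_m) + w·m` of the term `c_m x^m` of `f`. -/
def termWeight (v : AddValuation K (WithTop ℝ)) (w : Fin n → ℝ) (f : MvPolynomial (Fin n) K)
    (m : Fin n →₀ ℕ) : WithTop ℝ :=
  v (f.coeff m) + ((∑ i, (m i : ℝ) * w i : ℝ) : WithTop ℝ)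

/-- The exponents of the initial form `in_w(f)`: the exponents of the terms of `f` of minimal
`w`-weight. -/
def initSupport (v : AddValuation K (WithTop ℝ)) (w : Fin n → ℝ) (f : MvPolynomial (Fin n) K) :
    Set (Fin n →₀ ℕ) :=
  {m | m ∈ f.support ∧ ∀ m' ∈ f.support, termWeight v w f m ≤ termWeight v w f m'}

/-- The tropical hypersurface of `f`: the weights `w` such that `in_w(f)` is not a monomial,
i.e. (for `f ≠ 0`) the minimal `w`-weight is attained by at least two terms. It is `ℝⁿ` for
`f = 0`. -/
def tropHypersurface (v : AddValuation K (WithTop ℝ)) (f : MvPolynomial (Fin n) K) :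
    Set (Fin n → ℝ) :=
  {w | (initSupport v w f).ncard ≠ 1}

/-- The tropical variety of `I`: the weights `w` for which `I` contains no witness, i.e. no
polynomial whose initial form `in_w(f)` is a monomial. -/
def tropVariety (v : AddValuation K (WithTop ℝ)) (I : Ideal (MvPolynomial (Fin n) K)) :
    Set (Fin n → ℝ) :=
  {w | ∀ f ∈ I, w ∈ tropHypersurface v f}

/-- A tropical basis of `I`: a finite generating set of `I` such that `trop(I)` is the intersection
of the tropical hypersurfaces of its members. -/
def IsTropicalBasis (v : AddValuation K (WithTop ℝ)) (I : Ideal (MvPolynomial (Fin n) K))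
    (T : Finset (MvPolynomial (Fin n) K)) : Prop :=
  Ideal.span (T : Set (MvPolynomial (Fin n) K)) = I ∧
    tropVariety v I = ⋂ h ∈ T, tropHypersurface v h

/-- All (nonzero) coefficients of `f` have valuation zero. -/
def HasConstantCoeffs (v : AddValuation K (WithTop ℝ)) (f : MvPolynomial (Fin n) K) : Prop :=
  ∀ m ∈ f.support, v (f.coeff m) = 0

/-- The closed cell of `w` in the common refinement of the complexes dual to the regular
subdivisions of the Newton polytopes of the `h ∈ T`: all `u` such that every term that is minimal
in `h` with respect to `w` is also minimal with respect to `u`. In the case of constant coefficients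
it is the cone of `w` in the common refinement of the normal fans of the Newton polytopes, i.e. in
the normal fan of their Minkowski sum. -/
def dualCell (v : AddValuation K (WithTop ℝ)) (T : Finset (MvPolynomial (Fin n) K))
    (w : Fin n → ℝ) : Set (Fin n → ℝ) :=
  {u | ∀ h ∈ T, initSupport v w h ⊆ initSupport v u h}

/-- The complex of all cells `dualCell v T w`, which subdivides `ℝⁿ`. -/
def dualComplex (v : AddValuation K (WithTop ℝ)) (T : Finset (MvPolynomial (Fin n) K)) :
    Set (Set (Fin n → ℝ)) :=
  Set.range (dualCell v T)

/-- The complex on `trop(I)` given by `T`: the cells of `dualComplex v T` contained in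
`trop(I)`. -/
def tropComplex (v : AddValuation K (WithTop ℝ)) (I : Ideal (MvPolynomial (Fin n) K))
    (T : Finset (MvPolynomial (Fin n) K)) : Set (Set (Fin n → ℝ)) :=
  {σ ∈ dualComplex v T | σ ⊆ tropVariety v I}

end TropBasis

end

/-!
The proof replaces the whole tropical basis by one finite family of points. For constant
coefficients, the initial exponents of `h` with respect to `w` are the exponents of `h` at which the
functional `w` is minimal. Choosing one exponent from each nonzero `h ∈ T` and adding the choices up
gives a finite family of lattice points, indexed by the choices, whose convex hull is the Minkowski
sum of the Newton polytopes. A choice is minimal for `w` exactly if each of its members is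
(`mem_minIndices_exponentPoint_iff`), so the cells `dualCell v T w` are the normal cones
`{u | minIndices a w ⊆ minIndices a u}` of this family `a` (`dualCell_eq_normalCone`).

The normal cones of any finite family form a polyhedral complex, and so do those contained in a
given set (`isPolyhedralComplex_normalCone`). Because `trop(I)` is the intersection of the
hypersurfaces of the members of `T`, the cell of a point of `trop(I)` lies in `trop(I)`; this gives
the support of the complex.

For the count, the normal cone of `w` is sent to the face of the polytope on which `w` is minimal.
This is injective, and the span of the cone is the orthogonal complement of the direction of the
face (`mem_vectorSpan_normalCone_iff_dualAnnihilator`). Since the members of `T` are homogeneous,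
the vector `(1, …, 1)` lies in the span of every cone, so cones of dimension `j` modulo that vector
go to faces of dimension `n - j - 1`. Finally, a translate of the polytope along a basis vector lies
in `(s * d)·Δ_{n-1}`, because the degrees of the nonzero members of `T` add up to at most `s * d`.

The main tool for both parts is `exists_add_smul_mem_normalCone`: if `z` is constant on the points
minimal for `w`, then `w + ε z` stays in the normal cone of `w` for some `ε > 0`.
-/

namespace TropBasis

/-! ### Normal cones of a finite family of points -/

section NormalFan

variable {ι : Type*} {n : ℕ} (a : ι → Fin n → ℝ)

/-- The indices of the points `a i` on which the functional `w` is minimal. -/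
def minIndices (w : Fin n → ℝ) : Set ι :=
  {i | ∀ j, w ⬝ᵥ a i ≤ w ⬝ᵥ a j}

/-- The closed cone of `w` in the (inner) normal fan of the convex hull of the points `a i`. -/
def normalCone (w : Fin n → ℝ) : Set (Fin n → ℝ) :=
  {u | minIndices a w ⊆ minIndices a u}

variable {a}

theorem mem_normalCone_self (w : Fin n → ℝ) : w ∈ normalCone a w :=
  fun _ hi => hi

theorem mem_normalCone_trans {w u z : Fin n → ℝ} (hu : u ∈ normalCone a w)
    (hz : z ∈ normalCone a u) : z ∈ normalCone a w :=
  fun _ hi => hz (hu hi)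

theorem zero_mem_normalCone (w : Fin n → ℝ) : (0 : Fin n → ℝ) ∈ normalCone a w := by
  intro i _ j
  simp

theorem dotProduct_eq_of_mem_minIndices {w : Fin n → ℝ} {i j : ι} (hi : i ∈ minIndices a w)
    (hj : j ∈ minIndices a w) : w ⬝ᵥ a i = w ⬝ᵥ a j :=
  le_antisymm (hi j) (hj i)

theorem minIndices_nonempty [Finite ι] [Nonempty ι] (w : Fin n → ℝ) :
    (minIndices a w).Nonempty :=
  Finite.exists_min fun i => w ⬝ᵥ a i

theorem convex_normalCone (w : Fin n → ℝ) : Convex ℝ (normalCone a w) := by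
  intro u hu z hz p q hp hq _ i hi j
  simp only [add_dotProduct, smul_dotProduct, smul_eq_mul]
  exact add_le_add (mul_le_mul_of_nonneg_left (hu hi j) hp)
    (mul_le_mul_of_nonneg_left (hz hi j) hq)

theorem isPolyhedron_normalCone [Finite ι] (w : Fin n → ℝ) : IsPolyhedron (normalCone a w) := by
  refine ⟨Set.range fun p : minIndices a w × ι =>
    (dotProductEquiv ℝ (Fin n) (a p.2 - a p.1), (0 : ℝ)), Set.finite_range _, ?_⟩
  ext u
  simp only [Set.forall_mem_range, Set.mem_ofPred_eq, dotProductEquiv_apply_apply,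
    dotProduct_comm _ u, dotProduct_sub, sub_nonneg]
  exact ⟨fun h p => h p.1.2 p.2, fun h i hi j => h (⟨i, hi⟩, j)⟩

/-- A functional `z` that is constant on the points minimal for `w` spans, up to small scaling, a
direction in which one can move from `w` without leaving the normal cone of `w`. -/
theorem exists_add_smul_mem_normalCone [Finite ι] {w z : Fin n → ℝ}
    (hz : ∀ i ∈ minIndices a w, ∀ j ∈ minIndices a w, z ⬝ᵥ a i = z ⬝ᵥ a j) :
    ∃ ε : ℝ, 0 < ε ∧ w + ε • z ∈ normalCone a w := by
  have h : ∀ᶠ ε : ℝ in nhdsWithin 0 (Set.Ioi 0), ∀ (i : minIndices a w) (j : ι),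
      (w + ε • z) ⬝ᵥ a i ≤ (w + ε • z) ⬝ᵥ a j := by
    refine Filter.eventually_all.2 fun i => Filter.eventually_all.2 fun j => ?_
    simp only [add_dotProduct, smul_dotProduct, smul_eq_mul]
    by_cases hj : j ∈ minIndices a w
    · refine Filter.Eventually.of_forall fun ε => ?_
      rw [hz i i.2 j hj]
      exact add_le_add_left (i.2 j) _
    · have hlt : w ⬝ᵥ a i < w ⬝ᵥ a j := by
        by_contra! hle
        exact hj fun k => hle.trans (i.2 k)
      have hc (k : ι) : Filter.Tendsto (fun ε : ℝ => w ⬝ᵥ a k + ε * z ⬝ᵥ a k)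
          (nhdsWithin 0 (Set.Ioi 0)) (nhds (w ⬝ᵥ a k)) := by
        have : Continuous fun ε : ℝ => w ⬝ᵥ a k + ε * z ⬝ᵥ a k := by fun_prop
        simpa using (this.tendsto 0).mono_left nhdsWithin_le_nhds
      exact ((hc i).eventually_lt (hc j) hlt).mono fun _ => le_of_lt
  obtain ⟨ε, hε, hpos⟩ := (h.and self_mem_nhdsWithin).exists
  exact ⟨ε, hpos, fun i hi j => hε ⟨i, hi⟩ j⟩

variable (a) in
theorem finite_range_normalCone [Finite ι] : (Set.range (normalCone a)).Finite := by
  have h : normalCone a = (fun S : Set ι => {u | S ⊆ minIndices a u}) ∘ minIndices a := rfl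
  rw [h, Set.range_comp]
  exact (Set.toFinite _).image _

/-- Faces of normal cones are normal cones: a face is the cone of any of its points `u` with the
fewest minimal indices, that is, of any point in its relative interior. -/
theorem IsFaceOf.exists_eq_normalCone [Finite ι] [Nonempty ι] {F : Set (Fin n → ℝ)} {w : Fin n → ℝ}
    (hF : IsFaceOf F (normalCone a w)) : ∃ u, F = normalCone a u := by
  obtain ⟨hne, hexp⟩ := hF
  have hconv : Convex ℝ F := hexp.convex (convex_normalCone w)
  obtain ⟨l, hl⟩ := hexp hne
  obtain ⟨u, huF, hu⟩ := exists_minimalFor_of_wellFoundedLT (· ∈ F) (minIndices a) hne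
  have huσ : u ∈ normalCone a w := by rw [hl] at huF; exact huF.1
  refine ⟨u, Set.Subset.antisymm (fun z hz i hi => ?_) fun z hz => ?_⟩
  · -- The minimal indices of the midpoint of `u` and `z` are those common to `u` and `z`.
    have hmem : (1 / 2 : ℝ) • u + (1 / 2 : ℝ) • z ∈ F :=
      hconv huF hz (by norm_num) (by norm_num) (by norm_num)
    have hzσ : z ∈ normalCone a w := by rw [hl] at hz; exact hz.1
    obtain ⟨k, hk⟩ := minIndices_nonempty (a := a) w
    have hsub : minIndices a ((1 / 2 : ℝ) • u + (1 / 2 : ℝ) • z) ⊆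
        minIndices a u ∩ minIndices a z := by
      intro i hi
      have h1 := hi k
      simp only [add_dotProduct, smul_dotProduct, smul_eq_mul] at h1
      have h2 := huσ hk i
      have h3 := hzσ hk i
      exact ⟨fun j => le_trans (by linarith) (huσ hk j), fun j => le_trans (by linarith) (hzσ hk j)⟩
    exact (hsub (hu hmem (hsub.trans Set.inter_subset_left) hi)).2
  · -- Moving from `u` slightly away from `z` stays in the cone, so `l u ≤ l z`.
    obtain ⟨ε, hε, hmem⟩ := exists_add_smul_mem_normalCone (a := a) (w := u) (z := u - z)
      fun i hi j hj => by
        rw [sub_dotProduct, sub_dotProduct, dotProduct_eq_of_mem_minIndices hi hj,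
          dotProduct_eq_of_mem_minIndices (hz hi) (hz hj)]
    rw [hl] at huF ⊢
    have h1 := huF.2 _ (mem_normalCone_trans huσ hmem)
    simp only [map_add, map_smul, map_sub, smul_eq_mul] at h1
    have h2 : l u ≤ l z := by
      by_contra! h
      have := mul_pos hε (sub_pos.2 h)
      linarith
    exact ⟨mem_normalCone_trans huσ hz, fun y hy => (huF.2 y hy).trans h2⟩

/-- The intersection of two normal cones is cut out of the first one by the vanishing of a sum of
functionals that are nonpositive on it. -/
theorem isFaceOf_normalCone_inter [Finite ι] [Nonempty ι] (w z : Fin n → ℝ) :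
    IsFaceOf (normalCone a w ∩ normalCone a z) (normalCone a w) := by
  classical
  refine ⟨⟨0, zero_mem_normalCone w, zero_mem_normalCone z⟩, fun _ => ?_⟩
  obtain ⟨k, hk⟩ := minIndices_nonempty (a := a) w
  have := Fintype.ofFinite (minIndices a z)
  let l : (Fin n → ℝ) →L[ℝ] ℝ := LinearMap.toContinuousLinearMap
    (dotProductEquiv ℝ (Fin n) (∑ i : minIndices a z, (a k - a i)))
  have hl (u : Fin n → ℝ) : l u = ∑ i : minIndices a z, (u ⬝ᵥ a k - u ⬝ᵥ a i) := by
    simp only [l, LinearMap.coe_toContinuousLinearMap', dotProductEquiv_apply_apply,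
      dotProduct_comm _ u, dotProduct_sum, dotProduct_sub]
  refine ⟨l, Set.ext fun u => and_congr_right fun hu => ?_⟩
  have hle (y : Fin n → ℝ) (hy : y ∈ normalCone a w) :
      ∀ i ∈ (Finset.univ : Finset (minIndices a z)), y ⬝ᵥ a k - y ⬝ᵥ a i ≤ 0 :=
    fun i _ => sub_nonpos.2 (hy hk i)
  constructor
  · intro h y hy
    have h0 : l u = 0 := by
      rw [hl]
      exact Finset.sum_eq_zero fun i _ =>
        sub_eq_zero.2 (dotProduct_eq_of_mem_minIndices (hu hk) (h i.2))
    rw [h0, hl]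
    exact Finset.sum_nonpos (hle y hy)
  · intro h i hi j
    have h0 : l u = 0 := by
      refine le_antisymm ?_ (by simpa using h 0 (zero_mem_normalCone w))
      rw [hl]
      exact Finset.sum_nonpos (hle u hu)
    rw [hl, Finset.sum_eq_zero_iff_of_nonpos (hle u hu)] at h0
    have h1 := h0 ⟨i, hi⟩ (Finset.mem_univ _)
    have h2 := hu hk j
    simp only at h1
    linarith

theorem isPolyhedralComplex_normalCone [Finite ι] [Nonempty ι] (X : Set (Fin n → ℝ)) :
    IsPolyhedralComplex {σ ∈ Set.range (normalCone a) | σ ⊆ X} where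
  finite := (finite_range_normalCone a).subset (Set.sep_subset _ _)
  nonempty := by
    rintro _ ⟨⟨w, rfl⟩, -⟩
    exact ⟨w, mem_normalCone_self w⟩
  polyhedron := by
    rintro _ ⟨⟨w, rfl⟩, -⟩
    exact isPolyhedron_normalCone w
  face_mem := by
    rintro _ ⟨⟨w, rfl⟩, hX⟩ F hF
    obtain ⟨u, rfl⟩ := hF.exists_eq_normalCone
    exact ⟨⟨u, rfl⟩, (hF.2.subset).trans hX⟩
  inter_face := by
    rintro _ ⟨⟨w, rfl⟩, -⟩ _ ⟨⟨z, rfl⟩, -⟩ -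
    refine ⟨isFaceOf_normalCone_inter w z, ?_⟩
    rw [Set.inter_comm]
    exact isFaceOf_normalCone_inter z w

/-! ### Duality between normal cones and faces -/

variable (a) in
/-- The face of the convex hull of the points `a i` on which `w` is minimal. -/
def minFace (w : Fin n → ℝ) : Set (Fin n → ℝ) :=
  {x ∈ convexHull ℝ (Set.range a) | ∀ y ∈ convexHull ℝ (Set.range a), w ⬝ᵥ x ≤ w ⬝ᵥ y}

theorem dotProduct_le_of_mem_minIndices {w : Fin n → ℝ} {i : ι} (hi : i ∈ minIndices a w)
    {y : Fin n → ℝ} (hy : y ∈ convexHull ℝ (Set.range a)) : w ⬝ᵥ a i ≤ w ⬝ᵥ y := by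
  have hc : Convex ℝ {y : Fin n → ℝ | w ⬝ᵥ a i ≤ w ⬝ᵥ y} :=
    convex_halfSpace_ge (dotProductEquiv ℝ (Fin n) w).isLinear _
  refine convexHull_min ?_ hc hy
  rintro _ ⟨j, rfl⟩
  exact hi j

theorem apply_mem_minFace_iff {w : Fin n → ℝ} {i : ι} :
    a i ∈ minFace a w ↔ i ∈ minIndices a w :=
  ⟨fun h j => h.2 _ (subset_convexHull ℝ _ ⟨j, rfl⟩),
    fun h => ⟨subset_convexHull ℝ _ ⟨i, rfl⟩, fun _ => dotProduct_le_of_mem_minIndices h⟩⟩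

theorem normalCone_eq_of_minFace_eq {w z : Fin n → ℝ} (h : minFace a w = minFace a z) :
    normalCone a w = normalCone a z := by
  have : minIndices a w = minIndices a z := by
    ext i
    rw [← apply_mem_minFace_iff, h, apply_mem_minFace_iff]
  simp only [normalCone, this]

theorem isFaceOf_minFace [Finite ι] [Nonempty ι] (w : Fin n → ℝ) :
    IsFaceOf (minFace a w) (convexHull ℝ (Set.range a)) := by
  obtain ⟨i, hi⟩ := minIndices_nonempty (a := a) w
  refine ⟨⟨a i, apply_mem_minFace_iff.2 hi⟩, fun _ =>
    ⟨LinearMap.toContinuousLinearMap (dotProductEquiv ℝ (Fin n) (-w)), ?_⟩⟩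
  simp [minFace]

theorem IsFaceOf.exists_eq_minFace {F : Set (Fin n → ℝ)}
    (hF : IsFaceOf F (convexHull ℝ (Set.range a))) : ∃ w, F = minFace a w := by
  obtain ⟨hne, hexp⟩ := hF
  obtain ⟨l, hl⟩ := hexp hne
  refine ⟨-(dotProductEquiv ℝ (Fin n)).symm l.toLinearMap, ?_⟩
  have h (x : Fin n → ℝ) : (dotProductEquiv ℝ (Fin n)).symm l.toLinearMap ⬝ᵥ x = l x := by
    rw [← dotProductEquiv_apply_apply, LinearEquiv.apply_symm_apply]
    rfl
  simp [minFace, hl, h]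

/-- A functional is constant on the face where `w` is minimal as soon as it is constant on the
points `a i` in that face. -/
theorem dotProduct_eq_of_mem_minFace [Finite ι] {w z : Fin n → ℝ}
    (hz : ∀ i ∈ minIndices a w, ∀ j ∈ minIndices a w, z ⬝ᵥ a i = z ⬝ᵥ a j) {i : ι}
    (hi : i ∈ minIndices a w) {x : Fin n → ℝ} (hx : x ∈ minFace a w) : z ⬝ᵥ x = z ⬝ᵥ a i := by
  -- For small `ε > 0`, both `w + ε z` and `w - ε z` are minimal at `a i` on the convex hull.
  have key (z : Fin n → ℝ)
      (hz : ∀ i ∈ minIndices a w, ∀ j ∈ minIndices a w, z ⬝ᵥ a i = z ⬝ᵥ a j) :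
      z ⬝ᵥ a i ≤ z ⬝ᵥ x := by
    obtain ⟨ε, hε, hmem⟩ := exists_add_smul_mem_normalCone hz
    have h1 := dotProduct_le_of_mem_minIndices (hmem hi) hx.1
    have h2 := hx.2 _ (subset_convexHull ℝ _ ⟨i, rfl⟩)
    simp only [add_dotProduct, smul_dotProduct, smul_eq_mul] at h1
    exact le_of_mul_le_mul_left (by linarith) hε
  have h := key (-z) fun i hi j hj => by simp [hz i hi j hj]
  simp only [neg_dotProduct, neg_le_neg_iff] at h
  exact le_antisymm h (key z hz)

theorem minFace_subset_of_minIndices_eq [Finite ι] [Nonempty ι] {w z : Fin n → ℝ}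
    (h : minIndices a w = minIndices a z) : minFace a w ⊆ minFace a z := by
  intro x hx
  obtain ⟨i, hi⟩ := minIndices_nonempty (a := a) w
  have hz := dotProduct_eq_of_mem_minFace (z := z)
    (fun i hi j hj => dotProduct_eq_of_mem_minIndices (h ▸ hi) (h ▸ hj)) hi hx
  refine ⟨hx.1, fun y hy => ?_⟩
  rw [hz]
  exact dotProduct_le_of_mem_minIndices (h ▸ hi) hy

variable (a) in
theorem finite_setOf_isFaceOf [Finite ι] [Nonempty ι] :
    {F | IsFaceOf F (convexHull ℝ (Set.range a))}.Finite := by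
  have h : (Set.range (minFace a)).Finite := by
    refine Set.Finite.of_finite_image (f := fun F => {i | a i ∈ F}) (Set.toFinite _) ?_
    rintro _ ⟨w, rfl⟩ _ ⟨z, rfl⟩ hwz
    simp only [apply_mem_minFace_iff, Set.ofPred_mem_eq] at hwz
    exact (minFace_subset_of_minIndices_eq hwz).antisymm (minFace_subset_of_minIndices_eq hwz.symm)
  refine h.subset fun F hF => ?_
  obtain ⟨w, rfl⟩ := IsFaceOf.exists_eq_minFace hF
  exact ⟨w, rfl⟩

theorem mem_vectorSpan_normalCone_iff [Finite ι] {w z : Fin n → ℝ} :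
    z ∈ vectorSpan ℝ (normalCone a w) ↔
      ∀ i ∈ minIndices a w, ∀ j ∈ minIndices a w, z ⬝ᵥ a i = z ⬝ᵥ a j := by
  constructor
  · intro hz i hi j hj
    rw [vectorSpan_def] at hz
    induction hz using Submodule.span_induction with
    | mem x hx =>
      obtain ⟨p, hp, q, hq, rfl⟩ := hx
      simp only [vsub_eq_sub, sub_dotProduct, dotProduct_eq_of_mem_minIndices (hp hi) (hp hj),
        dotProduct_eq_of_mem_minIndices (hq hi) (hq hj)]
    | zero => simp
    | add x y _ _ hx hy => simp only [add_dotProduct, hx, hy]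
    | smul c x _ hx => simp only [smul_dotProduct, hx]
  · intro hz
    obtain ⟨ε, hε, hmem⟩ := exists_add_smul_mem_normalCone hz
    have h := vsub_mem_vectorSpan ℝ hmem (mem_normalCone_self w)
    rw [vsub_eq_sub, add_sub_cancel_left] at h
    exact ((vectorSpan ℝ (normalCone a w)).smul_mem_iff hε.ne').1 h

/-- The linear span of a normal cone is the orthogonal complement of the direction of the dual
face. -/
theorem mem_vectorSpan_normalCone_iff_dualAnnihilator [Finite ι] [Nonempty ι] {w z : Fin n → ℝ} :
    z ∈ vectorSpan ℝ (normalCone a w) ↔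
      dotProductEquiv ℝ (Fin n) z ∈ (vectorSpan ℝ (minFace a w)).dualAnnihilator := by
  rw [mem_vectorSpan_normalCone_iff, Submodule.mem_dualAnnihilator]
  constructor
  · intro hz x hx
    obtain ⟨k, hk⟩ := minIndices_nonempty (a := a) w
    rw [dotProductEquiv_apply_apply]
    rw [vectorSpan_def] at hx
    induction hx using Submodule.span_induction with
    | mem x hx =>
      obtain ⟨p, hp, q, hq, rfl⟩ := hx
      simp only [vsub_eq_sub, dotProduct_sub, dotProduct_eq_of_mem_minFace hz hk hp,
        dotProduct_eq_of_mem_minFace hz hk hq, sub_self]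
    | zero => simp
    | add x y _ _ hx hy => rw [dotProduct_add, hx, hy, add_zero]
    | smul c x _ hx => rw [dotProduct_smul, hx, smul_zero]
  · intro h i hi j hj
    have := h _ (vsub_mem_vectorSpan ℝ (apply_mem_minFace_iff.2 hi) (apply_mem_minFace_iff.2 hj))
    rwa [dotProductEquiv_apply_apply, vsub_eq_sub, dotProduct_sub, sub_eq_zero] at this

theorem affDim_minFace_add_affDim_normalCone [Finite ι] [Nonempty ι] (w : Fin n → ℝ) :
    affDim (minFace a w) + affDim (normalCone a w) = n := by
  have h : vectorSpan ℝ (normalCone a w) = (vectorSpan ℝ (minFace a w)).dualAnnihilator.comap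
      (dotProductEquiv ℝ (Fin n)).toLinearMap :=
    Submodule.ext fun _ => mem_vectorSpan_normalCone_iff_dualAnnihilator
  have h' := Subspace.finrank_add_finrank_dualAnnihilator_eq (vectorSpan ℝ (minFace a w))
  rw [Module.finrank_fin_fun] at h'
  rw [affDim, affDim, h, Submodule.comap_equiv_eq_map_symm, LinearEquiv.finrank_map_eq, h']

theorem projDim_add_one_of_ones_mem (hn : 1 ≤ n) {σ : Set (Fin n → ℝ)}
    (h : (fun _ => (1 : ℝ)) ∈ vectorSpan ℝ σ) : projDim σ + 1 = affDim σ := by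
  have hle : onesLine n ≤ vectorSpan ℝ σ := (Submodule.span_singleton_le_iff_mem _ _).2 h
  have hone : (fun _ : Fin n => (1 : ℝ)) ≠ 0 := fun h0 => one_ne_zero (congrFun h0 ⟨0, hn⟩)
  have h1 := ((onesLine n).mkQ.domRestrict (vectorSpan ℝ σ)).finrank_range_add_finrank_ker
  rw [LinearMap.range_domRestrict, LinearMap.ker_domRestrict, Submodule.ker_mkQ,
    (Submodule.comapSubtypeEquivOfLe hle).finrank_eq, onesLine, finrank_span_singleton hone] at h1
  exact h1

/-- Sending the normal cone of `w` to the face where `w` is minimal embeds the cones of projective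
dimension `j` into the faces of dimension `n - j - 1`. -/
theorem fVector_normalCone_le [Finite ι] [Nonempty ι] {r : ℝ} (ha : ∀ i, ∑ k, a i k = r)
    (X : Set (Fin n → ℝ)) {j : ℕ} (hj : j < n) :
    fVector {σ ∈ Set.range (normalCone a) | σ ⊆ X} j ≤
      faceNumber (convexHull ℝ (Set.range a)) (n - j - 1) := by
  let s : Set (Fin n → ℝ) → Fin n → ℝ := Function.invFun (normalCone a)
  have hs {σ : Set (Fin n → ℝ)} (hσ : σ ∈ Set.range (normalCone a)) : normalCone a (s σ) = σ :=
    Function.invFun_eq hσ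
  refine Set.ncard_le_ncard_of_injOn (fun σ => minFace a (s σ)) ?_ ?_
    ((finite_setOf_isFaceOf a).subset (Set.sep_subset _ _))
  · rintro σ ⟨⟨hσ, -⟩, hdim⟩
    refine ⟨isFaceOf_minFace _, ?_⟩
    have h1 := affDim_minFace_add_affDim_normalCone (a := a) (s σ)
    rw [hs hσ] at h1
    have h2 : projDim σ + 1 = affDim σ := by
      refine projDim_add_one_of_ones_mem (by lia) ?_
      rw [← hs hσ, mem_vectorSpan_normalCone_iff]
      intro i _ k _
      simp [dotProduct, ha]
    lia
  · rintro σ ⟨⟨hσ, -⟩, -⟩ τ ⟨⟨hτ, -⟩, -⟩ h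
    rw [← hs hσ, ← hs hτ]
    exact normalCone_eq_of_minFace_eq h

end NormalFan

/-! ### Initial forms in the case of constant coefficients -/

section ConstantCoeffs

variable {K : Type*} [Field K] {n : ℕ} {v : AddValuation K (WithTop ℝ)}

theorem mem_initSupport_iff {f : MvPolynomial (Fin n) K} (hf : HasConstantCoeffs v f)
    {w : Fin n → ℝ} {m : Fin n →₀ ℕ} :
    m ∈ initSupport v w f ↔ m ∈ f.support ∧
      ∀ m' ∈ f.support, (w ⬝ᵥ fun i => (m i : ℝ)) ≤ w ⬝ᵥ fun i => (m' i : ℝ) := by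
  refine and_congr_right fun hm => forall₂_congr fun m' hm' => ?_
  rw [termWeight, termWeight, hf m hm, hf m' hm', zero_add, zero_add, WithTop.coe_le_coe,
    dotProduct_comm, dotProduct_comm w]
  rfl

theorem initSupport_nonempty {f : MvPolynomial (Fin n) K} (hf0 : f ≠ 0) (w : Fin n → ℝ) :
    (initSupport v w f).Nonempty :=
  f.support.exists_min_image (termWeight v w f) (MvPolynomial.support_nonempty.2 hf0)

/-- Membership in a tropical hypersurface passes to weights with a larger initial support. -/
theorem mem_tropHypersurface_of_initSupport_subset {f : MvPolynomial (Fin n) K} {w u : Fin n → ℝ}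
    (h : initSupport v w f ⊆ initSupport v u f) (hw : w ∈ tropHypersurface v f) :
    u ∈ tropHypersurface v f := by
  by_cases hf : f = 0
  · -- The zero polynomial has empty initial support, so its hypersurface is everything.
    have : initSupport v u f = ∅ := Set.eq_empty_of_forall_notMem fun m hm => by
      simpa [hf] using hm.1
    change (initSupport v u f).ncard ≠ 1
    simp [this]
  · intro hu
    have hfin : (initSupport v u f).Finite := f.support.finite_toSet.subset fun m hm => hm.1
    have hpos := (Set.ncard_pos (hfin.subset h)).2 (initSupport_nonempty hf w)
    have hle := Set.ncard_le_ncard h hfin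
    exact hw (by lia)

variable {I : Ideal (MvPolynomial (Fin n) K)} {T : Finset (MvPolynomial (Fin n) K)}

theorem dualCell_subset_tropVariety (hT : IsTropicalBasis v I T) {w : Fin n → ℝ}
    (hw : w ∈ tropVariety v I) : dualCell v T w ⊆ tropVariety v I := by
  intro u hu
  rw [hT.2] at hw ⊢
  simp only [Set.mem_iInter] at hw ⊢
  exact fun h hh => mem_tropHypersurface_of_initSupport_subset (hu h hh) (hw h hh)

theorem sUnion_tropComplex (hT : IsTropicalBasis v I T) :
    ⋃₀ tropComplex v I T = tropVariety v I := by
  refine Set.Subset.antisymm (Set.sUnion_subset fun σ hσ => hσ.2) fun w hw => ?_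
  exact ⟨dualCell v T w, ⟨⟨w, rfl⟩, dualCell_subset_tropVariety hT hw⟩, fun _ _ _ hm => hm⟩

/-! ### The Minkowski sum of the Newton polytopes -/

open Classical in
variable (T) in
/-- A choice of an exponent in the support of each nonzero member of `T`. -/
abbrev ExponentChoice : Type _ :=
  (h : ↥(T.erase 0)) → ↥h.1.support

open Classical in
/-- The sum of the chosen exponents, translated by `c`. The convex hull of these points is a
translate of the Minkowski sum of the Newton polytopes of the nonzero members of `T`. -/
noncomputable def exponentSum (c : Fin n → ℕ) (p : ExponentChoice T) (i : Fin n) : ℕ :=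
  ∑ h, (p h).1 i + c i

/-- The points `exponentSum c p`, as vectors with real coordinates. -/
noncomputable def exponentPoint (c : Fin n → ℕ) (p : ExponentChoice T) (i : Fin n) : ℝ :=
  exponentSum c p i

open Classical in
theorem dotProduct_exponentPoint (c : Fin n → ℕ) (w : Fin n → ℝ) (p : ExponentChoice T) :
    w ⬝ᵥ exponentPoint c p =
      ∑ h, (w ⬝ᵥ fun i => ((p h).1 i : ℝ)) + w ⬝ᵥ fun i => (c i : ℝ) := by
  have : exponentPoint c p = ∑ h, (fun i => ((p h).1 i : ℝ)) + fun i => (c i : ℝ) := by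
    ext i
    simp [exponentPoint, exponentSum]
  rw [this, dotProduct_add, dotProduct_sum]

instance : Nonempty (ExponentChoice T) := by
  classical
  refine ⟨fun h => ?_⟩
  exact Classical.indefiniteDescription _
    (MvPolynomial.support_nonempty.2 (Finset.ne_of_mem_erase h.2))

/-- A sum of exponents is minimal for `w` if and only if each summand is. -/
theorem mem_minIndices_exponentPoint_iff (hconst : ∀ h ∈ T, HasConstantCoeffs v h)
    (c : Fin n → ℕ) {w : Fin n → ℝ} {p : ExponentChoice T} :
    p ∈ minIndices (exponentPoint c) w ↔ ∀ h, (p h).1 ∈ initSupport v w h.1 := by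
  classical
  have hc (h : ↥(T.erase 0)) : HasConstantCoeffs v h.1 := hconst h (Finset.mem_of_mem_erase h.2)
  constructor
  · intro hp h
    refine (mem_initSupport_iff (hc h)).2 ⟨(p h).2, fun m' hm' => ?_⟩
    by_contra! hlt
    -- Replacing `p h` by an exponent of smaller weight would decrease the sum.
    have h1 := hp (Function.update p h ⟨m', hm'⟩)
    rw [dotProduct_exponentPoint, dotProduct_exponentPoint] at h1
    refine absurd (le_of_add_le_add_right h1) (not_le.2 (Finset.sum_lt_sum ?_ ⟨h, ?_, ?_⟩))
    · intro k _
      by_cases hk : k = h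
      · subst hk
        simpa using hlt.le
      · simp [hk]
    · simp
    · simpa using hlt
  · intro hp q
    rw [dotProduct_exponentPoint, dotProduct_exponentPoint]
    gcongr with h
    exact ((mem_initSupport_iff (hc h)).1 (hp h)).2 _ (q h).2

theorem dualCell_eq_normalCone (hconst : ∀ h ∈ T, HasConstantCoeffs v h) (c : Fin n → ℕ) :
    dualCell v T = normalCone (exponentPoint (T := T) c) := by
  classical
  ext w u
  constructor
  · intro hu p hp
    rw [mem_minIndices_exponentPoint_iff hconst] at hp ⊢
    exact fun h => hu h (Finset.mem_of_mem_erase h.2) (hp h)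
  · intro hu h hh m hm
    have h0 : h ≠ 0 := by
      rintro rfl
      simpa using hm.1
    -- Complete `m` by arbitrary minimal exponents of the other members of `T`.
    have hex (k : ↥(T.erase 0)) := initSupport_nonempty (v := v) (Finset.ne_of_mem_erase k.2) w
    choose q hq using hex
    let h' : ↥(T.erase 0) := ⟨h, Finset.mem_erase.2 ⟨h0, hh⟩⟩
    let p : ExponentChoice T := Function.update (fun k => ⟨q k, (hq k).1⟩) h' ⟨m, hm.1⟩
    have hp : p ∈ minIndices (exponentPoint c) w := by
      refine (mem_minIndices_exponentPoint_iff hconst c).2 fun k => ?_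
      by_cases hk : k = h'
      · subst hk
        simpa [p] using hm
      · simpa [p, hk] using hq k
    have := (mem_minIndices_exponentPoint_iff hconst c).1 (hu hp) h'
    simpa [p] using this

/-- After a translation by a nonnegative multiple of a basis vector, the Minkowski sum of the Newton
polytopes of `T` lies in a dilate of the standard simplex. -/
theorem exists_sum_exponentSum_eq {d : ℕ} (hn : 1 ≤ n)
    (hhom : ∀ h ∈ T, ∃ e : ℕ, h.IsHomogeneous e) (hd : ∀ h ∈ T, h.totalDegree ≤ d) :
    ∃ c : Fin n → ℕ, ∀ p : ExponentChoice T, ∑ i, exponentSum c p i = T.card * d := by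
  classical
  have hle : ∑ h : ↥(T.erase 0), h.1.totalDegree ≤ T.card * d := by
    refine (Finset.sum_le_card_nsmul _ _ d fun h _ =>
      hd _ (Finset.mem_of_mem_erase h.2)).trans ?_
    rw [smul_eq_mul, Finset.card_univ, Fintype.card_coe]
    gcongr
    exact Finset.erase_subset _ _
  refine ⟨Pi.single ⟨0, hn⟩ (T.card * d - ∑ h : ↥(T.erase 0), h.1.totalDegree), fun p => ?_⟩
  have hdeg (h : ↥(T.erase 0)) : ∑ i, (p h).1 i = h.1.totalDegree := by
    obtain ⟨e, he⟩ := hhom _ (Finset.mem_of_mem_erase h.2)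
    rw [he.totalDegree (Finset.ne_of_mem_erase h.2), ← Finsupp.degree_eq_sum]
    by_contra hne
    exact MvPolynomial.mem_support_iff.1 (p h).2 (he.coeff_eq_zero hne)
  simp only [exponentSum]
  rw [Finset.sum_add_distrib, Finset.sum_comm, Finset.sum_congr rfl fun h _ => hdeg h,
    Finset.sum_pi_single']
  simp only [Finset.mem_univ, if_true]
  lia

theorem isLatticePolytope_exponentPoint (c : Fin n → ℕ) :
    IsLatticePolytope (convexHull ℝ (Set.range (exponentPoint (T := T) c))) := by
  classical
  refine ⟨Finset.univ.image fun (p : ExponentChoice T) i => (exponentSum c p i : ℤ),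
    Finset.univ_nonempty.image _, ?_⟩
  rw [Finset.coe_image, Finset.coe_univ, Set.image_univ, ← Set.range_comp]
  congr 2

end ConstantCoeffs

theorem mem_smul_stdSimplex {n N : ℕ} (hn : 1 ≤ n) {x : Fin n → ℝ} (h0 : ∀ i, 0 ≤ x i)
    (hx : ∑ i, x i = N) : x ∈ (N : ℝ) • stdSimplex ℝ (Fin n) := by
  obtain rfl | hN := Nat.eq_zero_or_pos N
  · -- In `0 • Δ`, the only point is the origin.
    refine ⟨Pi.single ⟨0, hn⟩ 1, single_mem_stdSimplex ℝ _, ?_⟩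
    rw [Nat.cast_zero, Finset.sum_eq_zero_iff_of_nonneg fun i _ => h0 i] at hx
    ext i
    simp [hx i]
  · have hN' : (0 : ℝ) < N := Nat.cast_pos.2 hN
    refine ⟨(N : ℝ)⁻¹ • x, ⟨fun i => mul_nonneg (inv_nonneg.2 hN'.le) (h0 i), ?_⟩, ?_⟩
    · simp only [Pi.smul_apply, smul_eq_mul, ← Finset.mul_sum, hx]
      exact inv_mul_cancel₀ hN'.ne'
    · exact smul_inv_smul₀ hN'.ne' x

end TropBasis

theorem mainTheorem5 {K : Type*} [Field K] (v : AddValuation K (WithTop ℝ)) (n s d : ℕ)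
    (I : Ideal (MvPolynomial (Fin n) K))
    (hI : TropBasis.IsHomogeneousIdeal I)
    (T : Finset (MvPolynomial (Fin n) K))
    (hT : TropBasis.IsTropicalBasis v I T)
    (hhom : ∀ h ∈ T, ∃ e : ℕ, h.IsHomogeneous e)
    (hconst : ∀ h ∈ T, TropBasis.HasConstantCoeffs v h)
    (hs : T.card = s)
    (hd : ∀ h ∈ T, h.totalDegree ≤ d) :
    TropBasis.IsPolyhedralComplex (TropBasis.tropComplex v I T) ∧
      ⋃₀ TropBasis.tropComplex v I T = TropBasis.tropVariety v I ∧
      ∀ j < n, TropBasis.fVector (TropBasis.tropComplex v I T) j ≤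
        TropBasis.lam (n - j - 1) (s * d) n := by
  classical
  have hcomplex (c : Fin n → ℕ) : TropBasis.tropComplex v I T =
      {σ ∈ Set.range (TropBasis.normalCone (TropBasis.exponentPoint (T := T) c)) |
        σ ⊆ TropBasis.tropVariety v I} := by
    rw [TropBasis.tropComplex, TropBasis.dualComplex, TropBasis.dualCell_eq_normalCone hconst c]
  refine ⟨?_, TropBasis.sUnion_tropComplex hT, fun j hj => ?_⟩
  · rw [hcomplex 0]
    exact TropBasis.isPolyhedralComplex_normalCone _
  · have hn : 1 ≤ n := by lia
    obtain ⟨c, hc⟩ := TropBasis.exists_sum_exponentSum_eq hn hhom hd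
    rw [hs] at hc
    have hsum (p : TropBasis.ExponentChoice T) :
        ∑ i, TropBasis.exponentPoint c p i = (s * d : ℕ) := by
      simp only [TropBasis.exponentPoint]
      exact_mod_cast hc p
    rw [hcomplex c]
    refine (TropBasis.fVector_normalCone_le hsum _ hj).trans
      ((TropBasis.isGreatest_lam _ _ hn).2
        ⟨_, TropBasis.isLatticePolytope_exponentPoint c, ?_, rfl⟩)
    refine convexHull_min ?_ ((convex_stdSimplex ℝ (Fin n)).smul _)
    rintro _ ⟨p, rfl⟩
    exact TropBasis.mem_smul_stdSimplex hn (fun i => Nat.cast_nonneg _) (hsum p)
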